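/- Let $(\mathcal A,\otimes,\mathbb 1)$ be a monoidal category (unit and associativity isomorphisms are suppressed below) and let $\mathbb B=(B,\mu,\eta)$ be an opmonoidal monad on $\mathcal A$ with constraints $B_2(X,Y)\colon B(X\otimes Y)\to BX\otimes BY$ and $B_0\colon B\mathbb 1\to\mathbb 1$, that is, $B$ is an opmonoidal functor and $\mu,\eta$ are opmonoidal natural transformations. Let $F\colon\mathcal A\rightleftarrows\mathcal A^{\mathbb B}\colon U$ be its Eilenberg–Moore adjunction and $\mathbb T$ the induced comonad on $\mathcal A^{\mathbb B}$, with $T=FU$. Assume that * $\mathbb B$ is a pre-Hopf monad: for every object $X$, the fusion operators $H^l_{\mathbb 1,X}=(B\mathbb 1\otimes\mu_X)\,B_2(\mathbb 1,BX)\colon B(\mathbb 1\otimes BX)\to B\mathbb 1\otimes BX$ and $H^r_{\mathbb 1,X}=(\mu_{\mathbb 1}\otimes BX)\,B_2(B\mathbb 1,X)\colon B(B\mathbb 1\otimes X)\to B\mathbb 1\otimes BX$ are isomorphisms; and * $F$ is comonadic: the comparison functor $\mathcal A\to(\mathcal A^{\mathbb B})_{\mathbb T}$ to the category of $\mathbb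 T$-coalgebras is an equivalence. Let $\mathbb C$ be the comonad on $\mathcal A$ with $C=B\mathbb 1\otimes-$, comultiplication $B_2(\mathbb 1,\mathbb 1)\otimes X$ and counit $B_0\otimes X$, and let $\theta_X=H^r_{\mathbb 1,X}\colon BC X\to CBX$, which is a mixed distributive law of $\mathbb B$ over $\mathbb C$. Let $\mathbb C^\theta$ be the lift of $\mathbb C$ to $\mathcal A^{\mathbb B}$, $C^\theta(X,\alpha)=(CX,\,C(\alpha)\theta_X)$, with the comultiplication and counit of $\mathbb C$. Let $\chi\colon TC^\theta\Rightarrow C^\theta T$ be the distributive law of $\mathbb T$ over $\mathbb C^\theta$ induced by this lift: $\chi=\Lambda U$, where $\Lambda\colon FC\Rightarrow C^\theta F$ is the mate of the identity $CU= UC^\theta$ under $F\dashv U$; explicitly $\chi_{(X,\alpha)}=\theta_X$. Let $V\colon(\mathcal A^{\mathbb B})_{\mathbb C^\theta}\to\mathcal A^{\mathbb B}$ be the forgetful functor from the category of $\mathbb C^\theta$-coalgebras, and let $\mathbb T^\theta$ be the comonad on $(\mathcal A^{\mathbb B})_{\mathbb C^\theta}$ given by $T^\theta((X,\alpha),\delta)=(T(X,\alpha),\,\chi_{(X,\alpha)}T(\delta))$,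 with the comultiplication and counit of $\mathbb T$. Finally let $K\colon\mathcal A\to(\mathcal A^{\mathbb B})_{\mathbb C^\theta}$ be the functor $K(X)=(F X,\,B_2(\mathbb 1,X))$, $K(f)=F(f)$, so that $VK=F$. Then $K$ is an equivalence of categories. Moreover, let $\bar K$ be any quasi-inverse of $K$, let $\xi\colon K\bar K\Rightarrow\mathrm{id}$ and $\phi\colon\mathrm{id}\Rightarrow\bar KK$ be the counit and unit of an adjunction $K\dashv\bar K$, and let $\overline{\mathbb T^\theta}$ be the conjugate comonad on $\mathcal A$, with underlying functor $\bar KT^\theta K$, comultiplication $\bar KT^\theta\xi^{-1}T^\theta K\circ\bar K\Delta^{\mathbb T^\theta}K$ and counit $\phi^{-1}\circ\bar K\varepsilon^{\mathbb T^\theta}K$. Then for every category $\mathcal Z$ and every functor $N\colon\mathcal A^{\mathbb B}\to\mathcal Z$ the assignment $\lambda\mapsto\overline{\nabla}$, $$\overline{\nabla}_X=\Bigl(NFX\xrightarrow{N(B_2(\mathbb 1,X))}NC^\theta FX\xrightarrow{\lambda_{FX}}NTFX=NVT^\theta KX\xrightarrow{NV\xi^{-1}_{T^\theta KX}}NF\bar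 KT^\theta KX\Bigr),$$ is a bijection from the set of left $\chi$-coalgebra structures on $N$, that is, natural transformations $\lambda\colon NC^\theta\Rightarrow NT$ with $$N\Delta^{\mathbb T}\circ\lambda=\lambda T\circ N\chi\circ\lambda C^\theta\circ N\Delta^{\mathbb C^\theta},\qquad N\varepsilon^{\mathbb T}\circ\lambda=N\varepsilon^{\mathbb C^\theta},$$ onto the set of $\overline{\mathbb T^\theta}$-opcoalgebra structures on $NF$, that is, natural transformations $\gamma\colon NF\Rightarrow NF\,\overline{T^\theta}$ with $$NF\Delta^{\overline{\mathbb T^\theta}}\circ\gamma=\gamma\,\overline{T^\theta}\circ\gamma,\qquad NF\varepsilon^{\overline{\mathbb T^\theta}}\circ\gamma=\mathrm{id}_{NF}.$$ -/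

import Mathlib

open CategoryTheory MonoidalCategory

universe v₁ v₂ v₃ u₁ u₂ u₃

namespace HopfMonads

section General

/-! ### Coalgebras and opcoalgebras -/

/-- `γ : M ⇒ M C` is a `C`-opcoalgebra structure on the functor `M`:
`M Δ ∘ γ = γ C ∘ γ` and `M ε ∘ γ = id`. -/
structure IsOpcoalgebra {C : Type u₁} [Category.{v₁} C] {Z : Type u₂} [Category.{v₂} Z]
    (Q : Comonad C) (M : C ⥤ Z) (γ : M ⟶ Q.toFunctor ⋙ M) : Prop where
  coassoc (X : C) :
    γ.app X ≫ M.map (Q.δ.app X) = γ.app X ≫ γ.app (Q.obj X)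
  counit (X : C) : γ.app X ≫ M.map (Q.ε.app X) = 𝟙 (M.obj X)

/-- For comonads `T`, `S` and a natural transformation `χ : T S ⇒ S T` (a distributive law),
`l : N S ⇒ N T` is a left `χ`-coalgebra structure on the functor `N`:
`N Δ^T ∘ l = l T ∘ N χ ∘ l S ∘ N Δ^S` and `N ε^T ∘ l = N ε^S`. -/
structure IsLeftCoalgebra {D : Type u₁} [Category.{v₁} D] {Z : Type u₂} [Category.{v₂} Z]
    {T S : Comonad D} (χ : S.toFunctor ⋙ T.toFunctor ⟶ T.toFunctor ⋙ S.toFunctor)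
    (N : D ⥤ Z) (l : S.toFunctor ⋙ N ⟶ T.toFunctor ⋙ N) : Prop where
  comul (X : D) :
    l.app X ≫ N.map (T.δ.app X) =
      N.map (S.δ.app X) ≫ l.app (S.obj X) ≫ N.map (χ.app X) ≫ l.app (T.obj X)
  counit (X : D) : l.app X ≫ N.map (T.ε.app X) = N.map (S.ε.app X)

/-! ### Conjugate comonads -/

/-- The conjugate comonad `K' Q K` of a comonad `Q` under an adjunction `K' ⊣ K`. When `K` is an
equivalence with quasi-inverse `K'`, and `ξ`, `φ` are the counit and unit of `K ⊣ K'`, the unit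
and counit of `K' ⊣ K` are `ξ⁻¹` and `φ⁻¹`. -/
def conjugateComonad {A : Type u₁} [Category.{v₁} A] {C : Type u₂} [Category.{v₂} C]
    {K' : C ⥤ A} {K : A ⥤ C} (adj : K' ⊣ K) (Q : Comonad C) : Comonad A where
  toFunctor := K ⋙ Q.toFunctor ⋙ K'
  ε :=
    { app := fun X => K'.map (Q.ε.app (K.obj X)) ≫ adj.counit.app X
      naturality := fun X Y f => by
        have := Q.ε.naturality (K.map f)
        dsimp at this ⊢
        rw [← K'.map_comp_assoc, this]
        simp }
  δ :=
    { app := fun X => K'.map (Q.δ.app (K.obj X)) ≫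
        K'.map (Q.map (adj.unit.app (Q.obj (K.obj X))))
      naturality := fun X Y f => by
        have h := Q.δ.naturality (K.map f)
        have h' := adj.unit.naturality (Q.map (K.map f))
        dsimp at h h' ⊢
        simp only [← K'.map_comp, ← Category.assoc]
        rw [h]
        simp only [Category.assoc, ← Q.map_comp]
        rw [h'] }
  coassoc X := by
    have h := Q.δ.naturality (adj.unit.app (Q.obj (K.obj X)))
    have h2 := adj.unit.naturality (Q.δ.app (K.obj X))
    have h3 := adj.unit.naturality (Q.map (adj.unit.app (Q.obj (K.obj X))))
    dsimp at h h2 h3 ⊢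
    simp only [← K'.map_comp]
    congr 1
    simp only [Category.assoc, ← Q.map_comp, K.map_comp, K'.map_comp]
    rw [reassoc_of% h, ← Q.map_comp, h3, ← reassoc_of% h2, Q.map_comp, Q.coassoc_assoc]
  left_counit X := by
    have h := Q.ε.naturality (adj.unit.app (Q.obj (K.obj X)))
    dsimp at h ⊢
    simp only [← K'.map_comp_assoc, Category.assoc]
    rw [h]
    simp
  right_counit X := by
    have h := adj.unit.naturality (Q.ε.app (K.obj X))
    dsimp at h ⊢
    simp only [← K'.map_comp, Category.assoc, ← Q.map_comp, K.map_comp]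
    rw [← reassoc_of% h]
    simp

/-! ### Distributive laws from adjunctions -/

section Adj

variable {A : Type u₁} [Category.{v₁} A] {D : Type u₂} [Category.{v₂} D]
  {F : A ⥤ D} {U : D ⥤ A}

/-- The mate `Λ = ε S F ∘ F Ω F ∘ F C η : F C ⇒ S F` of `Ω : C U ⇒ U S` under `F ⊣ U`. -/
def mate (adj : F ⊣ U) {C : A ⥤ A} {S : D ⥤ D} (Ω : U ⋙ C ⟶ S ⋙ U) : C ⋙ F ⟶ F ⋙ S where
  app X := F.map (C.map (adj.unit.app X)) ≫ F.map (Ω.app (F.obj X)) ≫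
    adj.counit.app (S.obj (F.obj X))
  naturality X Y f := by
    have h := adj.unit.naturality f
    have h2 := Ω.naturality (F.map f)
    dsimp at h h2 ⊢
    rw [← F.map_comp_assoc, ← C.map_comp, h, C.map_comp, F.map_comp_assoc,
      ← F.map_comp_assoc (C.map (U.map (F.map f))), h2]
    simp

/-- The transformation `χ = Λ U ∘ F Ω⁻¹ : T S ⇒ S T` for `T = F U` induced by an isomorphism
`Ω : C U ≅ U S` with mate `Λ`. -/
def inducedLaw (adj : F ⊣ U) {C : A ⥤ A} {S : D ⥤ D} (Ω : U ⋙ C ≅ S ⋙ U) :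
    S ⋙ adj.toComonad.toFunctor ⟶ adj.toComonad.toFunctor ⋙ S where
  app X := F.map (Ω.inv.app X) ≫ (mate adj Ω.hom).app (U.obj X)
  naturality X Y f := by
    have h := Ω.inv.naturality f
    have h2 := (mate adj Ω.hom).naturality (U.map f)
    dsimp at h h2
    change F.map (U.map (S.map f)) ≫ F.map (Ω.inv.app Y) ≫ (mate adj Ω.hom).app (U.obj Y) =
      (F.map (Ω.inv.app X) ≫ (mate adj Ω.hom).app (U.obj X)) ≫ S.map (F.map (U.map f))
    rw [← F.map_comp_assoc, h, F.map_comp_assoc, h2, Category.assoc]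

end Adj

/-! ### Mixed distributive laws, the lifted comonad, and entwined coalgebras -/

variable {A : Type u₁} [Category.{v₁} A]

/-- A mixed distributive law `θ : B C ⇒ C B` of a monad `B` over a comonad `C`. The first two
axioms say that `(C, θ)` is a lax endomorphism of `B`, the last two that `(B, θ)` is a colax
endomorphism of `C`. -/
structure MixedDistributiveLaw (B : Monad A) (C : Comonad A) where
  hom : C.toFunctor ⋙ B.toFunctor ⟶ B.toFunctor ⋙ C.toFunctor
  mul (X : A) : B.μ.app (C.obj X) ≫ hom.app X =
    B.map (hom.app X) ≫ hom.app (B.obj X) ≫ C.map (B.μ.app X)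
  unit (X : A) : B.η.app (C.obj X) ≫ hom.app X = C.map (B.η.app X)
  comul (X : A) : hom.app X ≫ C.δ.app (B.obj X) =
    B.map (C.δ.app X) ≫ hom.app (C.obj X) ≫ C.map (hom.app X)
  counit (X : A) : hom.app X ≫ C.ε.app (B.obj X) = B.map (C.ε.app X)

variable {B : Monad A} {C : Comonad A}

/-- The lift `C^θ` of `C` to the category of `B`-algebras:
`C^θ (X, α) = (C X, C α ∘ θ_X)`, with the comultiplication and counit of `C`. -/
def liftComonad (θ : MixedDistributiveLaw B C) : Comonad B.Algebra where
  obj X :=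
    { A := C.obj X.A
      a := θ.hom.app X.A ≫ C.map X.a
      unit := by
        rw [← Category.assoc, θ.unit, ← C.map_comp, X.unit]
        exact C.map_id X.A
      assoc := by
        have h := θ.hom.naturality X.a
        dsimp at h ⊢
        rw [← Category.assoc, θ.mul]
        simp only [Category.assoc, ← C.map_comp, X.assoc, B.map_comp]
        rw [reassoc_of% h, C.map_comp] }
  map {X Y} f :=
    { f := C.map f.f
      h := by
        have h := θ.hom.naturality f.f
        dsimp at h ⊢
        rw [reassoc_of% h, ← C.map_comp, f.h, C.map_comp, Category.assoc] }
  map_id X := by ext; simp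
  map_comp f g := by ext; simp
  ε :=
    { app := fun X =>
        { f := C.ε.app X.A
          h := by
            have h := C.ε.naturality X.a
            dsimp at h ⊢
            rw [Category.assoc, h, ← θ.counit, Category.assoc] }
      naturality := fun X Y f => by
        ext
        exact C.ε.naturality f.f }
  δ :=
    { app := fun X =>
        { f := C.δ.app X.A
          h := by
            have h := C.δ.naturality X.a
            dsimp at h ⊢
            rw [Category.assoc, h, reassoc_of% (θ.comul X.A), C.map_comp] }
      naturality := fun X Y f => by
        ext
        exact C.δ.naturality f.f }
  coassoc X := by
    ext
    exact C.coassoc X.A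
  left_counit X := by
    ext
    exact C.left_counit X.A
  right_counit X := by
    ext
    exact C.right_counit X.A

/-- The identity transformation `Ω : C U ≅ U C^θ` exhibiting `C^θ` as a lift of `C` through the
Eilenberg–Moore adjunction. -/
def liftIso (θ : MixedDistributiveLaw B C) :
    B.forget ⋙ C.toFunctor ≅ (liftComonad θ).toFunctor ⋙ B.forget :=
  NatIso.ofComponents (fun X => Iso.refl (C.obj X.A)) (fun f =>
    (Category.comp_id (C.map f.f)).trans (Category.id_comp (C.map f.f)).symm)

/-- The comonad `T = F U` on `B`-algebras induced by the Eilenberg–Moore adjunction `F ⊣ U`. -/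
abbrev freeComonad (B : Monad A) : Comonad B.Algebra := B.adj.toComonad

/-- The distributive law `χ : T C^θ ⇒ C^θ T` induced by `Ω`. -/
def chi (θ : MixedDistributiveLaw B C) :
    (liftComonad θ).toFunctor ⋙ (freeComonad B).toFunctor ⟶
      (freeComonad B).toFunctor ⋙ (liftComonad θ).toFunctor :=
  inducedLaw B.adj (liftIso θ)

theorem adj_unit_app (B : Monad A) (X : A) : B.adj.unit.app X = B.η.app X := by
  rw [Monad.adj_unit]

theorem adj_counit_app_f (B : Monad A) (X : B.Algebra) : (B.adj.counit.app X).f = X.a := by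
  rw [Monad.adj_counit]

theorem chi_app_f (θ : MixedDistributiveLaw B C) (X : B.Algebra) :
    ((chi θ).app X).f = θ.hom.app X.A := by
  have h0 : ((chi θ).app X).f = B.map (𝟙 (C.obj X.A)) ≫ B.map (C.map (B.adj.unit.app X.A)) ≫
      B.map (𝟙 (C.obj (B.obj X.A))) ≫
      (B.adj.counit.app ((liftComonad θ).obj (B.free.obj X.A))).f := rfl
  have h1 : (B.adj.counit.app ((liftComonad θ).obj (B.free.obj X.A))).f =
      θ.hom.app (B.obj X.A) ≫ C.map (B.μ.app X.A) := adj_counit_app_f B _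
  have h := θ.hom.naturality (B.η.app X.A)
  dsimp at h
  have h2 : θ.hom.app X.A ≫ C.map (B.map (B.η.app X.A)) ≫ C.map (B.μ.app X.A) =
      θ.hom.app X.A := by
    rw [← C.map_comp, B.right_unit]
    exact (congrArg _ (C.map_id _)).trans (Category.comp_id _)
  have h3 : B.map (C.map (B.adj.unit.app X.A)) = B.map (C.map (B.η.app X.A)) :=
    congrArg (fun t => B.map (C.map t)) (adj_unit_app B X.A)
  rw [h0, h1, h3, B.map_id, Category.id_comp]
  refine Eq.trans ?_ h2
  rw [← reassoc_of% h]
  refine congrArg (B.map (C.map (B.η.app X.A)) ≫ ·) ?_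
  refine (congrArg (· ≫ _) (B.map_id _)).trans (Category.id_comp _)

section Aux

variable (θ : MixedDistributiveLaw B C) {X Y : A}

theorem aux_counit (d : X ⟶ C.obj X) (h : d ≫ C.ε.app X = 𝟙 X) :
    (B.map d ≫ θ.hom.app X) ≫ C.ε.app (B.obj X) = 𝟙 (B.obj X) := by
  rw [Category.assoc, θ.counit]
  exact (B.map_comp _ _).symm.trans ((congrArg _ h).trans (B.map_id _))

theorem aux_coassoc (d : X ⟶ C.obj X) (h : d ≫ C.δ.app X = d ≫ C.map d) :
    (B.map d ≫ θ.hom.app X) ≫ C.δ.app (B.obj X) =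
      (B.map d ≫ θ.hom.app X) ≫ C.map (B.map d ≫ θ.hom.app X) := by
  have h2 : B.map (C.map d) ≫ θ.hom.app (C.obj X) =
    θ.hom.app X ≫ C.map (B.map d) := θ.hom.naturality d
  have h3 : B.map d ≫ B.map (C.δ.app X) = B.map d ≫ B.map (C.map d) :=
    (B.map_comp _ _).symm.trans ((congrArg _ h).trans (B.map_comp _ _))
  have h4 : C.map (B.map d ≫ θ.hom.app X) =
    C.map (B.map d) ≫ C.map (θ.hom.app X) := C.map_comp _ _
  rw [Category.assoc, θ.comul, reassoc_of% h3, reassoc_of% h2, h4, Category.assoc]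

theorem aux_map (d : X ⟶ C.obj X) (e : Y ⟶ C.obj Y) (f : X ⟶ Y)
    (h : d ≫ C.map f = f ≫ e) :
    (B.map d ≫ θ.hom.app X) ≫ C.map (B.map f) = B.map f ≫ B.map e ≫ θ.hom.app Y := by
  have h2 : B.map (C.map f) ≫ θ.hom.app Y = θ.hom.app X ≫ C.map (B.map f) :=
    θ.hom.naturality f
  have h3 : B.map d ≫ B.map (C.map f) = B.map f ≫ B.map e :=
    (B.map_comp _ _).symm.trans ((congrArg _ h).trans (B.map_comp _ _))
  rw [Category.assoc, ← h2, reassoc_of% h3]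

theorem aux_comul (d : X ⟶ C.obj X) :
    (B.map d ≫ θ.hom.app X) ≫ C.map (B.map (B.η.app X)) =
      B.map (B.η.app X) ≫ B.map (B.map d ≫ θ.hom.app X) ≫ θ.hom.app (B.obj X) := by
  have h : d ≫ B.η.app (C.obj X) = B.η.app X ≫ B.map d := B.η.naturality d
  have h2 : B.map (C.map (B.η.app X)) ≫ θ.hom.app (B.obj X) =
    θ.hom.app X ≫ C.map (B.map (B.η.app X)) := θ.hom.naturality (B.η.app X)
  have h5 : B.η.app X ≫ B.map d ≫ θ.hom.app X = d ≫ C.map (B.η.app X) := by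
    rw [← reassoc_of% h, θ.unit]
  have h6 : B.map (B.η.app X) ≫ B.map (B.map d ≫ θ.hom.app X) =
      B.map d ≫ B.map (C.map (B.η.app X)) :=
    (B.map_comp _ _).symm.trans ((congrArg _ h5).trans (B.map_comp _ _))
  rw [Category.assoc, reassoc_of% h6, h2]

end Aux

/-- The coaction on `T^θ ((X, α), δ)`. -/
def extensionCoaction (θ : MixedDistributiveLaw B C) (Y : (liftComonad θ).Coalgebra) :
    (freeComonad B).obj Y.A ⟶ (liftComonad θ).obj ((freeComonad B).obj Y.A) :=
  (freeComonad B).map Y.a ≫ (chi θ).app Y.A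

theorem extensionCoaction_f (θ : MixedDistributiveLaw B C) (Y : (liftComonad θ).Coalgebra) :
    (extensionCoaction θ Y).f = B.map Y.a.f ≫ θ.hom.app Y.A.A :=
  congrArg (B.map Y.a.f ≫ ·) (chi_app_f θ Y.A)

/-- The comonad `T^θ` on the category of entwined coalgebras (coalgebras over `C^θ`):
`T^θ ((X, α), δ) = (T (X, α), χ_{(X, α)} ∘ T δ)`, with the comultiplication and counit of `T`. -/
def extensionComonad (θ : MixedDistributiveLaw B C) : Comonad (liftComonad θ).Coalgebra where
  obj Y :=
    { A := (freeComonad B).obj Y.A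
      a := extensionCoaction θ Y
      counit := by
        apply Monad.Algebra.Hom.ext
        change (extensionCoaction θ Y).f ≫ C.ε.app (B.obj Y.A.A) = 𝟙 (B.obj Y.A.A)
        rw [extensionCoaction_f]
        exact aux_counit θ Y.a.f (congrArg Monad.Algebra.Hom.f Y.counit)
      coassoc := by
        apply Monad.Algebra.Hom.ext
        change (extensionCoaction θ Y).f ≫ C.δ.app (B.obj Y.A.A) =
          (extensionCoaction θ Y).f ≫ C.map (extensionCoaction θ Y).f
        rw [extensionCoaction_f]
        exact aux_coassoc θ Y.a.f (congrArg Monad.Algebra.Hom.f Y.coassoc) }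
  map {Y Z} f :=
    { f := (freeComonad B).map f.f
      h := by
        apply Monad.Algebra.Hom.ext
        change (extensionCoaction θ Y).f ≫ C.map (B.map f.f.f) =
          B.map f.f.f ≫ (extensionCoaction θ Z).f
        rw [extensionCoaction_f, extensionCoaction_f]
        exact aux_map θ Y.a.f Z.a.f f.f.f (congrArg Monad.Algebra.Hom.f f.h) }
  map_id Y := Comonad.Coalgebra.Hom.ext ((freeComonad B).map_id Y.A)
  map_comp f g := Comonad.Coalgebra.Hom.ext ((freeComonad B).map_comp f.f g.f)
  ε :=
    { app := fun Y =>
        { f := (freeComonad B).ε.app Y.A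
          h := by
            apply Monad.Algebra.Hom.ext
            change (extensionCoaction θ Y).f ≫ C.map (B.adj.counit.app Y.A).f =
              (B.adj.counit.app Y.A).f ≫ Y.a.f
            rw [extensionCoaction_f, adj_counit_app_f]
            exact (Category.assoc _ _ _).trans Y.a.h }
      naturality := fun _ _ f => Comonad.Coalgebra.Hom.ext ((freeComonad B).ε.naturality f.f) }
  δ :=
    { app := fun Y =>
        { f := (freeComonad B).δ.app Y.A
          h := by
            apply Monad.Algebra.Hom.ext
            change (extensionCoaction θ Y).f ≫ C.map (B.map (B.adj.unit.app Y.A.A)) =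
              B.map (B.adj.unit.app Y.A.A) ≫ B.map (extensionCoaction θ Y).f ≫
                ((chi θ).app ((freeComonad B).obj Y.A)).f
            have h3 : B.adj.unit.app Y.A.A = B.η.app Y.A.A := adj_unit_app B _
            have h4 : ((chi θ).app ((freeComonad B).obj Y.A)).f = θ.hom.app (B.obj Y.A.A) :=
              chi_app_f θ _
            rw [h3, h4, extensionCoaction_f]
            exact aux_comul θ Y.a.f }
      naturality := fun _ _ f => Comonad.Coalgebra.Hom.ext ((freeComonad B).δ.naturality f.f) }
  coassoc Y := Comonad.Coalgebra.Hom.ext ((freeComonad B).coassoc Y.A)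
  left_counit Y := Comonad.Coalgebra.Hom.ext ((freeComonad B).left_counit Y.A)
  right_counit Y := Comonad.Coalgebra.Hom.ext ((freeComonad B).right_counit Y.A)

/-! ### The correspondence of coalgebra structures -/

/-- The transformation `∇ = l V ∘ N V η' : N V ⇒ N V T^θ` associated with `l : N C^θ ⇒ N T`, where
`V` is the forgetful functor on entwined coalgebras, with `V T^θ = T V`, and
`η'_{(X, α), δ} = δ` is the unit of the forgetful-cofree adjunction. -/
def nabla (θ : MixedDistributiveLaw B C) {Z : Type u₃} [Category.{v₃} Z] (N : B.Algebra ⥤ Z)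
    (l : (liftComonad θ).toFunctor ⋙ N ⟶ (freeComonad B).toFunctor ⋙ N) :
    (liftComonad θ).forget ⋙ N ⟶
      (extensionComonad θ).toFunctor ⋙ (liftComonad θ).forget ⋙ N where
  app Y := N.map Y.a ≫ l.app Y.A
  naturality Y Y' f := by
    have h := l.naturality f.f
    change N.map f.f ≫ N.map Y'.a ≫ l.app Y'.A =
      (N.map Y.a ≫ l.app Y.A) ≫ N.map ((freeComonad B).map f.f)
    change N.map ((liftComonad θ).map f.f) ≫ l.app Y'.A =
      l.app Y.A ≫ N.map ((freeComonad B).map f.f) at h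
    rw [Category.assoc, ← h, ← N.map_comp_assoc, ← N.map_comp_assoc, f.h]

/-- The transformation `M ξ⁻¹ Q K ∘ ∇ K : M K ⇒ M K (K' Q K)` associated with `∇ : M ⇒ M Q`,
where `ξ⁻¹` is the unit of `K' ⊣ K`. -/
def conjugateNabla {E : Type u₂} [Category.{v₂} E] {Z : Type u₃} [Category.{v₃} Z]
    {K' : E ⥤ A} {K : A ⥤ E} (adj : K' ⊣ K) (Q : Comonad E) (M : E ⥤ Z)
    (n : M ⟶ Q.toFunctor ⋙ M) :
    K ⋙ M ⟶ (conjugateComonad adj Q).toFunctor ⋙ K ⋙ M where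
  app X := n.app (K.obj X) ≫ M.map (adj.unit.app (Q.obj (K.obj X)))
  naturality X Y f := by
    have h : M.map (K.map f) ≫ n.app (K.obj Y) =
      n.app (K.obj X) ≫ M.map (Q.map (K.map f)) := n.naturality (K.map f)
    have h' : Q.map (K.map f) ≫ adj.unit.app (Q.obj (K.obj Y)) =
      adj.unit.app (Q.obj (K.obj X)) ≫ K.map (K'.map (Q.map (K.map f))) :=
        adj.unit.naturality (Q.map (K.map f))
    change M.map (K.map f) ≫ n.app (K.obj Y) ≫ M.map (adj.unit.app (Q.obj (K.obj Y))) =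
      (n.app (K.obj X) ≫ M.map (adj.unit.app (Q.obj (K.obj X)))) ≫
        M.map (K.map (K'.map (Q.map (K.map f))))
    rw [reassoc_of% h, Category.assoc, ← M.map_comp, ← M.map_comp, h']

end General

/-! ### Opmonoidal monads -/

section Opmonoidal

open Functor.OplaxMonoidal

variable {A : Type u₁} [Category.{v₁} A] [MonoidalCategory A]

/-- A monad whose underlying functor is opmonoidal (with constraints `B_2 = δ` and `B_0 = η`) is
an opmonoidal monad if its multiplication and unit are opmonoidal natural transformations. -/
class IsOpmonoidal (B : Monad A) [B.toFunctor.OplaxMonoidal] : Prop where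
  mul_tensor (X Y : A) : B.μ.app (X ⊗ Y) ≫ δ B.toFunctor X Y =
    B.map (δ B.toFunctor X Y) ≫ δ B.toFunctor (B.obj X) (B.obj Y) ≫ (B.μ.app X ⊗ₘ B.μ.app Y)
  mul_unit : B.μ.app (𝟙_ A) ≫ η B.toFunctor = B.map (η B.toFunctor) ≫ η B.toFunctor
  unit_tensor (X Y : A) : B.η.app (X ⊗ Y) ≫ δ B.toFunctor X Y = B.η.app X ⊗ₘ B.η.app Y
  unit_unit : B.η.app (𝟙_ A) ≫ η B.toFunctor = 𝟙 (𝟙_ A)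

variable (B : Monad A) [B.toFunctor.OplaxMonoidal]

/-- The left fusion operator `H^l_{X,Y} : B (X ⊗ B Y) ⟶ B X ⊗ B Y`. -/
def leftFusion (X Y : A) : B.obj (X ⊗ B.obj Y) ⟶ B.obj X ⊗ B.obj Y :=
  δ B.toFunctor X (B.obj Y) ≫ B.obj X ◁ B.μ.app Y

/-- The right fusion operator `H^r_{X,Y} : B (B X ⊗ Y) ⟶ B X ⊗ B Y`. -/
def rightFusion (X Y : A) : B.obj (B.obj X ⊗ Y) ⟶ B.obj X ⊗ B.obj Y :=
  δ B.toFunctor (B.obj X) Y ≫ B.μ.app X ▷ B.obj Y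

/-- An opmonoidal monad is pre-Hopf if `H^l_{𝟙,-}` and `H^r_{𝟙,-}` are isomorphisms. -/
structure IsPreHopf : Prop where
  left (X : A) : IsIso (leftFusion B (𝟙_ A) X)
  right (X : A) : IsIso (rightFusion B (𝟙_ A) X)

/-- The comultiplication `B 𝟙 ≅ B (𝟙 ⊗ 𝟙) ⟶ B 𝟙 ⊗ B 𝟙`. -/
def unitComul : B.obj (𝟙_ A) ⟶ B.obj (𝟙_ A) ⊗ B.obj (𝟙_ A) :=
  B.map (λ_ (𝟙_ A)).inv ≫ δ B.toFunctor (𝟙_ A) (𝟙_ A)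

theorem unitComul_assoc : unitComul B ≫ B.obj (𝟙_ A) ◁ unitComul B =
    unitComul B ≫ unitComul B ▷ B.obj (𝟙_ A) ≫ (α_ _ _ _).hom := by
  simp only [unitComul, whiskerLeft_comp, comp_whiskerRight, Category.assoc]
  rw [δ_natural_right_assoc, δ_natural_left_assoc, associativity, ← B.map_comp_assoc,
    ← B.map_comp_assoc, ← B.map_comp_assoc, leftUnitor_inv_whiskerRight]
  simp only [Category.assoc, Iso.inv_hom_id, Category.comp_id, leftUnitor_inv_naturality]

theorem unitComul_left : unitComul B ≫ η B.toFunctor ▷ B.obj (𝟙_ A) = (λ_ _).inv := by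
  rw [left_unitality B.toFunctor, unitComul, Category.assoc]

theorem unitComul_right : unitComul B ≫ B.obj (𝟙_ A) ◁ η B.toFunctor = (ρ_ _).inv := by
  rw [right_unitality B.toFunctor, unitComul, Category.assoc, unitors_inv_equal]

/-- The comonad `C = B 𝟙 ⊗ -`, with comultiplication induced by `B_2(𝟙, 𝟙)` and counit induced
by `B_0`. -/
def tensorComonad : Comonad A where
  toFunctor := tensorLeft (B.obj (𝟙_ A))
  ε :=
    { app := fun X => η B.toFunctor ▷ X ≫ (λ_ X).hom
      naturality := fun X Y f => by
        dsimp
        rw [whisker_exchange_assoc, Category.assoc, leftUnitor_naturality] }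
  δ :=
    { app := fun X => unitComul B ▷ X ≫ (α_ _ _ _).hom
      naturality := fun X Y f => by
        dsimp
        rw [whisker_exchange_assoc]
        simp }
  coassoc X := by
    have h := congrArg (· ▷ X) (unitComul_assoc B)
    dsimp at h ⊢
    simp only [comp_whiskerRight, Category.assoc, whiskerLeft_comp] at h ⊢
    rw [← associator_naturality_middle_assoc, reassoc_of% h]
    simp
  left_counit X := by
    have h := congrArg (· ▷ X) (unitComul_left B)
    dsimp at h ⊢
    simp only [comp_whiskerRight, Category.assoc] at h ⊢
    rw [← associator_naturality_left_assoc, reassoc_of% h, leftUnitor_tensor_hom]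
    simp only [Iso.hom_inv_id_assoc, inv_hom_whiskerRight]
  right_counit X := by
    have h := congrArg (· ▷ X) (unitComul_right B)
    dsimp at h ⊢
    simp only [comp_whiskerRight, Category.assoc, whiskerLeft_comp] at h ⊢
    rw [← associator_naturality_middle_assoc, reassoc_of% h, triangle]
    simp only [inv_hom_whiskerRight]

theorem fusion_naturality {X Y : A} (f : X ⟶ Y) :
    B.map (B.obj (𝟙_ A) ◁ f) ≫ rightFusion B (𝟙_ A) Y =
      rightFusion B (𝟙_ A) X ≫ B.obj (𝟙_ A) ◁ B.map f := by
  rw [rightFusion, rightFusion, ← δ_natural_right_assoc, Category.assoc, whisker_exchange]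

/-- The coaction `B X ≅ B (𝟙 ⊗ X) ⟶ B 𝟙 ⊗ B X` given by `B_2(𝟙, X)`. -/
def freeCoaction (X : A) : B.obj X ⟶ B.obj (𝟙_ A) ⊗ B.obj X :=
  B.map (λ_ X).inv ≫ δ B.toFunctor (𝟙_ A) X

theorem freeCoaction_naturality {X Y : A} (f : X ⟶ Y) :
    freeCoaction B X ≫ B.obj (𝟙_ A) ◁ B.map f = B.map f ≫ freeCoaction B Y := by
  rw [freeCoaction, freeCoaction, Category.assoc, δ_natural_right, ← B.map_comp_assoc,
    ← B.map_comp_assoc, leftUnitor_inv_naturality]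

theorem freeCoaction_counit (X : A) :
    freeCoaction B X ≫ η B.toFunctor ▷ B.obj X ≫ (λ_ (B.obj X)).hom = 𝟙 (B.obj X) := by
  rw [freeCoaction, Category.assoc, left_unitality_hom, ← B.map_comp, Iso.inv_hom_id, B.map_id]

theorem freeCoaction_coassoc (X : A) :
    freeCoaction B X ≫ unitComul B ▷ B.obj X ≫ (α_ _ _ _).hom =
      freeCoaction B X ≫ B.obj (𝟙_ A) ◁ freeCoaction B X := by
  simp only [freeCoaction, unitComul, whiskerLeft_comp, comp_whiskerRight, Category.assoc]
  rw [δ_natural_right_assoc, δ_natural_left_assoc, associativity, ← B.map_comp_assoc,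
    ← B.map_comp_assoc, ← B.map_comp_assoc]
  simp

variable [IsOpmonoidal B]

theorem mul_unitComul : B.μ.app (𝟙_ A) ≫ unitComul B =
    B.map (unitComul B) ≫ δ B.toFunctor (B.obj (𝟙_ A)) (B.obj (𝟙_ A)) ≫
      (B.μ.app (𝟙_ A) ⊗ₘ B.μ.app (𝟙_ A)) := by
  have h : B.map (B.map (λ_ (𝟙_ A)).inv) ≫ B.μ.app (𝟙_ A ⊗ 𝟙_ A) =
    B.μ.app (𝟙_ A) ≫ B.map (λ_ (𝟙_ A)).inv := B.μ.naturality _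
  rw [unitComul, ← reassoc_of% h, IsOpmonoidal.mul_tensor, B.map_comp, Category.assoc]

theorem fusion_mul (X : A) : B.μ.app (B.obj (𝟙_ A) ⊗ X) ≫ rightFusion B (𝟙_ A) X =
    B.map (rightFusion B (𝟙_ A) X) ≫ rightFusion B (𝟙_ A) (B.obj X) ≫
      B.obj (𝟙_ A) ◁ B.μ.app X := by
  simp only [rightFusion, B.map_comp, Category.assoc]
  rw [← Category.assoc, IsOpmonoidal.mul_tensor, ← δ_natural_left_assoc]
  simp only [Category.assoc, tensorHom_def', ← comp_whiskerRight_assoc, ← comp_whiskerRight,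
    B.assoc]
  rw [whisker_exchange]
  rfl

theorem fusion_unit (X : A) : B.η.app (B.obj (𝟙_ A) ⊗ X) ≫ rightFusion B (𝟙_ A) X =
    B.obj (𝟙_ A) ◁ B.η.app X := by
  rw [rightFusion, ← Category.assoc, IsOpmonoidal.unit_tensor, tensorHom_def', Category.assoc,
    ← comp_whiskerRight, B.left_unit]
  simp

theorem fusion_comul (X : A) :
    rightFusion B (𝟙_ A) X ≫ unitComul B ▷ B.obj X ≫ (α_ _ _ _).hom =
      B.map (unitComul B ▷ X ≫ (α_ _ _ _).hom) ≫ rightFusion B (𝟙_ A) (B.obj (𝟙_ A) ⊗ X) ≫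
        B.obj (𝟙_ A) ◁ rightFusion B (𝟙_ A) X := by
  simp only [rightFusion, Category.assoc, B.map_comp, whiskerLeft_comp]
  rw [← comp_whiskerRight_assoc, mul_unitComul, ← whisker_exchange_assoc]
  refine Eq.trans ?_ (congrArg (B.map (unitComul B ▷ X) ≫ ·)
    (associativity_assoc B.toFunctor (B.obj (𝟙_ A)) (B.obj (𝟙_ A)) X
      (B.μ.app (𝟙_ A) ▷ (B.obj (B.obj (𝟙_ A)) ⊗ B.obj X) ≫
        B.obj (𝟙_ A) ◁ B.μ.app (𝟙_ A) ▷ B.obj X)))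
  simp only [MonoidalCategory.tensorHom_def, comp_whiskerRight, Category.assoc]
  rw [δ_natural_left_assoc]
  simp

theorem fusion_counit (X : A) :
    rightFusion B (𝟙_ A) X ≫ η B.toFunctor ▷ B.obj X ≫ (λ_ (B.obj X)).hom =
      B.map (η B.toFunctor ▷ X ≫ (λ_ X).hom) := by
  rw [rightFusion, Category.assoc, ← comp_whiskerRight_assoc, IsOpmonoidal.mul_unit,
    comp_whiskerRight, Category.assoc, δ_natural_left_assoc, left_unitality_hom, ← B.map_comp]

/-- The mixed distributive law
`θ_X = (μ_𝟙 ⊗ B X) ∘ B_2(B 𝟙, X) = H^r_{𝟙,X} : B (B 𝟙 ⊗ X) ⟶ B 𝟙 ⊗ B X`. -/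
def fusionLaw : MixedDistributiveLaw B (tensorComonad B) where
  hom :=
    { app := fun X => rightFusion B (𝟙_ A) X
      naturality := fun _ _ f => fusion_naturality B f }
  mul X := fusion_mul B X
  unit X := fusion_unit B X
  comul X := fusion_comul B X
  counit X := fusion_counit B X

theorem freeCoaction_hom (X : A) :
    B.map (freeCoaction B X) ≫ rightFusion B (𝟙_ A) (B.obj X) ≫ B.obj (𝟙_ A) ◁ B.μ.app X =
      B.μ.app X ≫ freeCoaction B X := by
  have h : B.map (B.map (λ_ X).inv) ≫ B.μ.app (𝟙_ A ⊗ X) =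
    B.μ.app X ≫ B.map (λ_ X).inv := B.μ.naturality _
  rw [freeCoaction, ← reassoc_of% h, IsOpmonoidal.mul_tensor, B.map_comp, Category.assoc,
    rightFusion, Category.assoc, MonoidalCategory.tensorHom_def]

/-- The functor `K : A ⥤ (A^B)_{C^θ}` with `K X = (F X, B_2(𝟙, X))`. -/
def comparisonK : A ⥤ (liftComonad (fusionLaw B)).Coalgebra where
  obj X :=
    { A := B.free.obj X
      a :=
        { f := freeCoaction B X
          h := freeCoaction_hom B X }
      counit := Monad.Algebra.Hom.ext (freeCoaction_counit B X)
      coassoc := Monad.Algebra.Hom.ext (freeCoaction_coassoc B X) }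
  map f :=
    { f := B.free.map f
      h := Monad.Algebra.Hom.ext (freeCoaction_naturality B f) }
  map_id X := Comonad.Coalgebra.Hom.ext (B.free.map_id X)
  map_comp f g := Comonad.Coalgebra.Hom.ext (B.free.map_comp f g)

theorem comparisonK_forget : comparisonK B ⋙ (liftComonad (fusionLaw B)).forget = B.free := rfl

/-- The transformation `N F ⇒ N F (K' T^θ K)` associated with `l : N C^θ ⇒ N T`. -/
def conjugateOpcoalgebra {Z : Type u₃} [Category.{v₃} Z] (N : B.Algebra ⥤ Z)
    {K' : (liftComonad (fusionLaw B)).Coalgebra ⥤ A} (adj : K' ⊣ comparisonK B)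
    (l : (liftComonad (fusionLaw B)).toFunctor ⋙ N ⟶ (freeComonad B).toFunctor ⋙ N) :
    B.free ⋙ N ⟶
      (conjugateComonad adj (extensionComonad (fusionLaw B))).toFunctor ⋙ B.free ⋙ N :=
  conjugateNabla adj (extensionComonad (fusionLaw B)) ((liftComonad (fusionLaw B)).forget ⋙ N)
    (nabla (fusionLaw B) N l)

end Opmonoidal

end HopfMonads

/-!
Transposition along the adjunction between the forgetful functor `V` of `C^θ`-coalgebras and the
cofree functor identifies `Nat(N C^θ, N T)` with `Nat(N V, N V T^θ)`, because `V T^θ = T V`; under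
this identification the axioms of a left `χ`-coalgebra structure on `N` become those of a
`T^θ`-opcoalgebra structure on `N V`. If `K` is an equivalence with `V K = F`, conjugation by `K`
carries the latter bijectively to opcoalgebra structures on `N V K = N F`.

That `K` is an equivalence comes from comonadicity of `F`: the coaction `B_2(𝟙, -)` of `C^θ` on the
left adjoint `F` corresponds to a comonad morphism `T ⟶ C^θ`, and `K` is the comparison functor of
`F` followed by the functor between categories of coalgebras induced by this morphism. On a free
algebra `F X` the morphism is the fusion operator `H^l_{𝟙,X}`; every algebra is a coequalizer of
free ones, split in the underlying category, so invertibility of these operators makes the comonad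
morphism an isomorphism.
-/

namespace HopfMonads

section Opcoalgebra

variable {E : Type u₁} [Category.{v₁} E] {Z : Type u₂} [Category.{v₂} Z]

theorem isOpcoalgebra_iff (Q : Comonad E) (M : E ⥤ Z) (n : M ⟶ Q.toFunctor ⋙ M) :
    IsOpcoalgebra Q M n ↔
      n ≫ Functor.whiskerRight Q.δ M = n ≫ Functor.whiskerLeft Q.toFunctor n ∧
        n ≫ Functor.whiskerRight Q.ε M = 𝟙 M :=
  ⟨fun h => ⟨NatTrans.ext (funext h.coassoc), NatTrans.ext (funext h.counit)⟩,
    fun h => ⟨NatTrans.congr_app h.1, NatTrans.congr_app h.2⟩⟩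

theorem isLeftCoalgebra_iff {T S : Comonad E}
    (χ : S.toFunctor ⋙ T.toFunctor ⟶ T.toFunctor ⋙ S.toFunctor)
    (N : E ⥤ Z) (l : S.toFunctor ⋙ N ⟶ T.toFunctor ⋙ N) :
    IsLeftCoalgebra χ N l ↔
      l ≫ Functor.whiskerRight T.δ N =
          Functor.whiskerRight S.δ N ≫ Functor.whiskerLeft S.toFunctor l ≫
            Functor.whiskerRight χ N ≫ Functor.whiskerLeft T.toFunctor l ∧
        l ≫ Functor.whiskerRight T.ε N = Functor.whiskerRight S.ε N :=
  ⟨fun h => ⟨NatTrans.ext (funext h.comul), NatTrans.ext (funext h.counit)⟩,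
    fun h => ⟨NatTrans.congr_app h.1, NatTrans.congr_app h.2⟩⟩

end Opcoalgebra

section CofreeTranspose

variable {D : Type u₁} [Category.{v₁} D] {Z : Type u₂} [Category.{v₂} Z]

/-- The bijection `Nat(N S, P) ≃ Nat(N V, P V)` for the forgetful functor `V` of `S`-coalgebras:
precomposition with the cofree functor is left adjoint to precomposition with `V`. -/
def cofreeTranspose (S : Comonad D) (N P : D ⥤ Z) :
    (S.toFunctor ⋙ N ⟶ P) ≃ (S.forget ⋙ N ⟶ S.forget ⋙ P) :=
  (S.adj.whiskerLeft Z).homEquiv (S.forget ⋙ N) P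

theorem cofreeTranspose_app (S : Comonad D) (N P : D ⥤ Z) (l : S.toFunctor ⋙ N ⟶ P)
    (Y : S.Coalgebra) : (cofreeTranspose S N P l).app Y = N.map Y.a ≫ l.app Y.A := by
  have unit_f : (S.adj.unit.app Y).f = Y.a := by rw [Comonad.adj_unit]
  have h := NatTrans.congr_app ((S.adj.whiskerLeft Z).homEquiv_unit (S.forget ⋙ N) P l) Y
  rw [NatTrans.comp_app, Adjunction.whiskerLeft_unit_app_app] at h
  exact h.trans (congrArg (fun f => N.map f ≫ l.app Y.A) unit_f)

theorem cofreeTranspose_counit (S : Comonad D) (N : D ⥤ Z) :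
    cofreeTranspose S N N (Functor.whiskerRight S.ε N) = 𝟙 (S.forget ⋙ N) := by
  ext Y
  rw [cofreeTranspose_app]
  change N.map Y.a ≫ N.map (S.ε.app Y.A) = 𝟙 (N.obj Y.A)
  rw [← N.map_comp, Y.counit, N.map_id]

variable {A : Type u₁} [Category.{v₁} A] {B : Monad A} {C : Comonad A}
  (θ : MixedDistributiveLaw B C) (N : B.Algebra ⥤ Z)

theorem nabla_eq_cofreeTranspose
    (l : (liftComonad θ).toFunctor ⋙ N ⟶ (freeComonad B).toFunctor ⋙ N) :
    nabla θ N l =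
      cofreeTranspose (liftComonad θ) N ((freeComonad B).toFunctor ⋙ N) l :=
  NatTrans.ext (funext fun _ => (cofreeTranspose_app ..).symm)

theorem nabla_bijective : Function.Bijective (nabla θ N) := by
  have h : nabla θ N = cofreeTranspose (liftComonad θ) N ((freeComonad B).toFunctor ⋙ N) :=
    funext (nabla_eq_cofreeTranspose θ N)
  rw [h]
  exact Equiv.bijective _

variable (l : (liftComonad θ).toFunctor ⋙ N ⟶ (freeComonad B).toFunctor ⋙ N)

theorem nabla_comp_comul :
    nabla θ N l ≫ Functor.whiskerRight (extensionComonad θ).δ ((liftComonad θ).forget ⋙ N) =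
      cofreeTranspose (liftComonad θ) N _ (l ≫ Functor.whiskerRight (freeComonad B).δ N) := by
  ext Y
  rw [cofreeTranspose_app]
  exact Category.assoc _ _ _

theorem nabla_comp_counit :
    nabla θ N l ≫ Functor.whiskerRight (extensionComonad θ).ε ((liftComonad θ).forget ⋙ N) =
      cofreeTranspose (liftComonad θ) N _ (l ≫ Functor.whiskerRight (freeComonad B).ε N) := by
  ext Y
  rw [cofreeTranspose_app]
  exact Category.assoc _ _ _

theorem nabla_comp_nabla :
    nabla θ N l ≫ Functor.whiskerLeft (extensionComonad θ).toFunctor (nabla θ N l) =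
      cofreeTranspose (liftComonad θ) N _
        (Functor.whiskerRight (liftComonad θ).δ N ≫
          Functor.whiskerLeft (liftComonad θ).toFunctor l ≫
            Functor.whiskerRight (chi θ) N ≫ Functor.whiskerLeft (freeComonad B).toFunctor l) := by
  ext Y
  have hl : N.map ((liftComonad θ).map Y.a) ≫ l.app ((liftComonad θ).obj Y.A) =
      l.app Y.A ≫ N.map ((freeComonad B).map Y.a) := l.naturality Y.a
  rw [cofreeTranspose_app]
  change (N.map Y.a ≫ l.app Y.A) ≫ N.map ((freeComonad B).map Y.a ≫ (chi θ).app Y.A) ≫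
      l.app ((freeComonad B).obj Y.A) =
    N.map Y.a ≫ N.map ((liftComonad θ).δ.app Y.A) ≫ l.app ((liftComonad θ).obj Y.A) ≫
      N.map ((chi θ).app Y.A) ≫ l.app ((freeComonad B).obj Y.A)
  rw [N.map_comp, Category.assoc, Category.assoc, ← reassoc_of% hl, ← N.map_comp_assoc,
    ← N.map_comp_assoc, Y.coassoc]

theorem isOpcoalgebra_nabla_iff :
    IsOpcoalgebra (extensionComonad θ) ((liftComonad θ).forget ⋙ N) (nabla θ N l) ↔
      IsLeftCoalgebra (chi θ) N l := by
  rw [isOpcoalgebra_iff, isLeftCoalgebra_iff, nabla_comp_comul, nabla_comp_nabla,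
    nabla_comp_counit, ← cofreeTranspose_counit]
  exact and_congr (Equiv.apply_eq_iff_eq _) (Equiv.apply_eq_iff_eq _)

theorem bijOn_nabla :
    Set.BijOn (nabla θ N) {l | IsLeftCoalgebra (chi θ) N l}
      {n | IsOpcoalgebra (extensionComonad θ) ((liftComonad θ).forget ⋙ N) n} :=
  (Equiv.ofBijective _ (nabla_bijective θ N)).bijOn (isOpcoalgebra_nabla_iff θ N)

end CofreeTranspose

section Conjugation

variable {A : Type u₁} [Category.{v₁} A] {E : Type u₂} [Category.{v₂} E]
  {Z : Type u₃} [Category.{v₃} Z] {K : A ⥤ E}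

theorem whiskerLeft_bijective (K : A ⥤ E) [K.IsEquivalence] (M P : E ⥤ Z) :
    Function.Bijective (Functor.whiskerLeft K : (M ⟶ P) → (K ⋙ M ⟶ K ⋙ P)) :=
  (Functor.FullyFaithful.ofFullyFaithful
    ((Functor.whiskeringLeft A E Z).obj K)).map_bijective M P

variable {K' : E ⥤ A} (adj : K' ⊣ K) (Q : Comonad E) (M : E ⥤ Z)

/-- The transformation `M ξ⁻¹ Q K : M Q K ⇒ M K (K' Q K)`, where `ξ⁻¹` is the unit of `K' ⊣ K`;
the conjugate of `n : M ⇒ M Q` is `n K` followed by it. -/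
def conjugationUnit : K ⋙ Q.toFunctor ⋙ M ⟶ (conjugateComonad adj Q).toFunctor ⋙ K ⋙ M :=
  Functor.whiskerRight (Functor.whiskerLeft (K ⋙ Q.toFunctor) adj.unit) M

instance [K.IsEquivalence] : IsIso (conjugationUnit adj Q M) := by
  have (X : A) : IsIso ((conjugationUnit adj Q M).app X) :=
    inferInstanceAs (IsIso (M.map (adj.unit.app (Q.obj (K.obj X)))))
  exact NatIso.isIso_of_isIso_app _

theorem conjugateNabla_bijective [K.IsEquivalence] : Function.Bijective (conjugateNabla adj Q M) :=
  (((asIso (conjugationUnit adj Q M)).homToEquiv).bijective).comp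
    (whiskerLeft_bijective K M (Q.toFunctor ⋙ M))

variable (n : M ⟶ Q.toFunctor ⋙ M)

theorem conjugateNabla_comp_comul :
    conjugateNabla adj Q M n ≫ Functor.whiskerRight (conjugateComonad adj Q).δ (K ⋙ M) =
      Functor.whiskerLeft K (n ≫ Functor.whiskerRight Q.δ M) ≫
        conjugationUnit adj Q (Q.toFunctor ⋙ M) ≫
          Functor.whiskerLeft (conjugateComonad adj Q).toFunctor (conjugationUnit adj Q M) := by
  ext X
  have unit_comul : adj.unit.app (Q.obj (K.obj X)) ≫
      K.map (K'.map (Q.δ.app (K.obj X)) ≫ K'.map (Q.map (adj.unit.app (Q.obj (K.obj X))))) =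
      Q.δ.app (K.obj X) ≫ Q.map (adj.unit.app (Q.obj (K.obj X))) ≫
        adj.unit.app (Q.obj (K.obj (K'.obj (Q.obj (K.obj X))))) := by
    rw [← K'.map_comp]
    exact (adj.unit_naturality _).trans (Category.assoc _ _ _)
  change (n.app (K.obj X) ≫ M.map (adj.unit.app (Q.obj (K.obj X)))) ≫ M.map (K.map _) =
    (n.app (K.obj X) ≫ M.map (Q.δ.app (K.obj X))) ≫ M.map (Q.map _) ≫ M.map (adj.unit.app _)
  rw [Category.assoc, Category.assoc, ← M.map_comp, ← M.map_comp, ← M.map_comp]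
  exact congrArg (fun f => n.app (K.obj X) ≫ M.map f) unit_comul

theorem conjugateNabla_comp_conjugateNabla :
    conjugateNabla adj Q M n ≫
        Functor.whiskerLeft (conjugateComonad adj Q).toFunctor (conjugateNabla adj Q M n) =
      Functor.whiskerLeft K (n ≫ Functor.whiskerLeft Q.toFunctor n) ≫
        conjugationUnit adj Q (Q.toFunctor ⋙ M) ≫
          Functor.whiskerLeft (conjugateComonad adj Q).toFunctor (conjugationUnit adj Q M) := by
  ext X
  have h : M.map (adj.unit.app (Q.obj (K.obj X))) ≫ n.app (K.obj (K'.obj (Q.obj (K.obj X)))) =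
      n.app (Q.obj (K.obj X)) ≫ M.map (Q.map (adj.unit.app (Q.obj (K.obj X)))) := n.naturality _
  change (n.app (K.obj X) ≫ M.map (adj.unit.app (Q.obj (K.obj X)))) ≫
      n.app (K.obj (K'.obj (Q.obj (K.obj X)))) ≫ M.map (adj.unit.app _) =
    (n.app (K.obj X) ≫ n.app (Q.obj (K.obj X))) ≫
      M.map (Q.map (adj.unit.app (Q.obj (K.obj X)))) ≫ M.map (adj.unit.app _)
  rw [Category.assoc, reassoc_of% h, Category.assoc]
  rfl

theorem conjugateNabla_comp_counit :
    conjugateNabla adj Q M n ≫ Functor.whiskerRight (conjugateComonad adj Q).ε (K ⋙ M) =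
      Functor.whiskerLeft K (n ≫ Functor.whiskerRight Q.ε M) := by
  ext X
  have unit_counit : adj.unit.app (Q.obj (K.obj X)) ≫
      K.map (K'.map (Q.ε.app (K.obj X)) ≫ adj.counit.app X) = Q.ε.app (K.obj X) := by
    rw [K.map_comp]
    exact (adj.unit_naturality_assoc _ _).trans <|
      (congrArg _ (adj.right_triangle_components X)).trans (Category.comp_id _)
  change (n.app (K.obj X) ≫ M.map (adj.unit.app (Q.obj (K.obj X)))) ≫
      M.map (K.map (K'.map (Q.ε.app (K.obj X)) ≫ adj.counit.app X)) =
    n.app (K.obj X) ≫ M.map (Q.ε.app (K.obj X))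
  rw [Category.assoc, ← M.map_comp, unit_counit]

theorem isOpcoalgebra_conjugateNabla_iff [K.IsEquivalence] :
    IsOpcoalgebra (conjugateComonad adj Q) (K ⋙ M) (conjugateNabla adj Q M n) ↔
      IsOpcoalgebra Q M n := by
  rw [isOpcoalgebra_iff, isOpcoalgebra_iff, conjugateNabla_comp_comul,
    conjugateNabla_comp_conjugateNabla, conjugateNabla_comp_counit, cancel_mono]
  exact and_congr (whiskerLeft_bijective K M ((Q.toFunctor ⋙ Q.toFunctor) ⋙ M)).injective.eq_iff
    ((whiskerLeft_bijective K M (𝟭 E ⋙ M)).injective.eq_iff (b := 𝟙 M))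

theorem bijOn_conjugateNabla [K.IsEquivalence] :
    Set.BijOn (conjugateNabla adj Q M) {n | IsOpcoalgebra Q M n}
      {γ | IsOpcoalgebra (conjugateComonad adj Q) (K ⋙ M) γ} :=
  (Equiv.ofBijective _ (conjugateNabla_bijective adj Q M)).bijOn
    fun n => isOpcoalgebra_conjugateNabla_iff adj Q M n

end Conjugation

section Correspondence

variable {A : Type u₁} [Category.{v₁} A] {B : Monad A} {C : Comonad A}
  {E : Type u₂} [Category.{v₂} E] {Z : Type u₃} [Category.{v₃} Z]

theorem bijOn_conjugateNabla_nabla (θ : MixedDistributiveLaw B C) (N : B.Algebra ⥤ Z)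
    {K' : (liftComonad θ).Coalgebra ⥤ E} {K : E ⥤ (liftComonad θ).Coalgebra} (adj : K' ⊣ K)
    [K.IsEquivalence] :
    Set.BijOn
      (conjugateNabla adj (extensionComonad θ) ((liftComonad θ).forget ⋙ N) ∘ nabla θ N)
      {l | IsLeftCoalgebra (chi θ) N l}
      {γ | IsOpcoalgebra (conjugateComonad adj (extensionComonad θ))
        (K ⋙ (liftComonad θ).forget ⋙ N) γ} :=
  (bijOn_conjugateNabla adj (extensionComonad θ) ((liftComonad θ).forget ⋙ N)).comp
    (bijOn_nabla θ N)

end Correspondence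

section ComonadMorphism

variable {D : Type u₁} [Category.{v₁} D] {T S : Comonad D}

/-- The functor from `T`-coalgebras to `S`-coalgebras induced by a comonad morphism `T ⟶ S`. -/
def coalgebraFunctor (κ : T ⟶ S) : T.Coalgebra ⥤ S.Coalgebra where
  obj Y :=
    { A := Y.A
      a := Y.a ≫ κ.app Y.A
      counit := by
        rw [Category.assoc, ComonadHom.app_ε, Y.counit]
      coassoc := by
        rw [Category.assoc, ComonadHom.app_δ, Y.coassoc_assoc, S.map_comp, κ.naturality_assoc,
          Category.assoc] }
  map {Y Y'} f :=
    { f := f.f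
      h := by
        change (Y.a ≫ κ.app Y.A) ≫ S.map f.f = f.f ≫ Y'.a ≫ κ.app Y'.A
        rw [Category.assoc, ← κ.naturality, f.h_assoc] }

theorem inv_comp_app (κ : T ≅ S) (X : D) : κ.inv.app X ≫ κ.hom.app X = 𝟙 (S.obj X) :=
  congrArg (fun φ : S ⟶ S => φ.app X) κ.inv_hom_id

/-- Isomorphic comonads have equivalent categories of coalgebras. -/
def coalgebraEquivalence (κ : T ≅ S) : T.Coalgebra ≌ S.Coalgebra where
  functor := coalgebraFunctor κ.hom
  inverse := coalgebraFunctor κ.inv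
  unitIso := NatIso.ofComponents
    (fun Y => Comonad.Coalgebra.isoMk (Iso.refl Y.A) (by
      have h : κ.hom.app Y.A ≫ κ.inv.app Y.A = 𝟙 (T.obj Y.A) := inv_comp_app κ.symm Y.A
      simp [coalgebraFunctor, h]))
    (fun f => Comonad.Coalgebra.Hom.ext ((Category.comp_id f.f).trans (Category.id_comp f.f).symm))
  counitIso := NatIso.ofComponents
    (fun Y => Comonad.Coalgebra.isoMk (Iso.refl Y.A) (by
      simp [coalgebraFunctor, inv_comp_app]))
    (fun f => Comonad.Coalgebra.Hom.ext ((Category.comp_id f.f).trans (Category.id_comp f.f).symm))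
  functor_unitIso_comp Y := Comonad.Coalgebra.Hom.ext (Category.comp_id (𝟙 Y.A))

theorem isEquivalence_coalgebraFunctor (κ : T ⟶ S) [hκ : ∀ X, IsIso (κ.app X)] :
    (coalgebraFunctor κ).IsEquivalence := by
  have (X : D) : IsIso (((comonadToFunctor D).map κ).app X) := hκ X
  have : IsIso ((comonadToFunctor D).map κ) := NatIso.isIso_of_isIso_app _
  have := isIso_of_reflects_iso κ (comonadToFunctor D)
  exact (coalgebraEquivalence (asIso κ)).isEquivalence_functor

end ComonadMorphism

section Coaction

variable {A : Type u₁} [Category.{v₁} A] {D : Type u₂} [Category.{v₂} D]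

/-- A coaction `F ⇒ S F` of a comonad `S` on a functor `F`, that is, a lift of `F` to the category
of `S`-coalgebras. -/
structure Coaction (S : Comonad D) (F : A ⥤ D) where
  hom : F ⟶ F ⋙ S.toFunctor
  counit (X : A) : hom.app X ≫ S.ε.app (F.obj X) = 𝟙 (F.obj X)
  coassoc (X : A) : hom.app X ≫ S.δ.app (F.obj X) = hom.app X ≫ S.map (hom.app X)

namespace Coaction

variable {S : Comonad D} {F : A ⥤ D} (b : Coaction S F)

theorem naturality {X Y : A} (f : X ⟶ Y) :
    F.map f ≫ b.hom.app Y = b.hom.app X ≫ S.map (F.map f) :=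
  b.hom.naturality f

/-- The lift of `F` to `S`-coalgebras with coactions given by `b`. -/
def lift : A ⥤ S.Coalgebra where
  obj X :=
    { A := F.obj X
      a := b.hom.app X
      counit := b.counit X
      coassoc := b.coassoc X }
  map f :=
    { f := F.map f
      h := (b.naturality f).symm }

variable {U : D ⥤ A} (adj : F ⊣ U)

/-- The comonad morphism `F U ⟶ S` corresponding to a coaction of `S` on a left adjoint `F`. -/
def comonadHom : adj.toComonad ⟶ S where
  app Y := b.hom.app (U.obj Y) ≫ S.map (adj.counit.app Y)
  naturality Y Y' f := by
    change F.map (U.map f) ≫ b.hom.app (U.obj Y') ≫ S.map (adj.counit.app Y') =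
      (b.hom.app (U.obj Y) ≫ S.map (adj.counit.app Y)) ≫ S.map f
    rw [reassoc_of% b.naturality (U.map f), Category.assoc, ← S.map_comp, ← S.map_comp]
    exact congrArg (b.hom.app (U.obj Y) ≫ S.map ·) (adj.counit_naturality f)
  app_ε Y := by
    have counit_naturality : S.map (adj.counit.app Y) ≫ S.ε.app Y =
        S.ε.app (F.obj (U.obj Y)) ≫ adj.counit.app Y := S.ε.naturality (adj.counit.app Y)
    change (b.hom.app (U.obj Y) ≫ S.map (adj.counit.app Y)) ≫ S.ε.app Y = adj.counit.app Y
    rw [Category.assoc, counit_naturality, reassoc_of% b.counit (U.obj Y)]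
  app_δ Y := by
    have comul_naturality : S.map (adj.counit.app Y) ≫ S.δ.app Y =
        S.δ.app (F.obj (U.obj Y)) ≫ S.map (S.map (adj.counit.app Y)) :=
      S.δ.naturality (adj.counit.app Y)
    change (b.hom.app (U.obj Y) ≫ S.map (adj.counit.app Y)) ≫ S.δ.app Y =
      F.map (adj.unit.app (U.obj Y)) ≫
        (b.hom.app (U.obj (F.obj (U.obj Y))) ≫ S.map (adj.counit.app (F.obj (U.obj Y)))) ≫
          S.map (b.hom.app (U.obj Y) ≫ S.map (adj.counit.app Y))
    rw [Category.assoc, Category.assoc, reassoc_of% b.naturality (adj.unit.app (U.obj Y)),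
      ← S.map_comp_assoc (F.map _), adj.left_triangle_components, comul_naturality,
      reassoc_of% b.coassoc (U.obj Y), S.map_comp, S.map_id, Category.id_comp]

theorem map_unit_comp_comonadHom (X : A) :
    F.map (adj.unit.app X) ≫ (b.comonadHom adj).app (F.obj X) = b.hom.app X := by
  change F.map (adj.unit.app X) ≫ b.hom.app (U.obj (F.obj X)) ≫ S.map (adj.counit.app (F.obj X)) =
    b.hom.app X
  rw [reassoc_of% b.naturality (adj.unit.app X), ← S.map_comp, adj.left_triangle_components,
    S.map_id, Category.comp_id]

/-- The lift of `F` factors through the comparison functor of `F ⊣ U`. -/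
def comparisonIso : Comonad.comparison adj ⋙ coalgebraFunctor (b.comonadHom adj) ≅ b.lift :=
  NatIso.ofComponents
    (fun X => Comonad.Coalgebra.isoMk (Iso.refl (F.obj X)) (
      (congrArg _ (S.map_id (F.obj X))).trans <| (Category.comp_id _).trans <|
        (b.map_unit_comp_comonadHom adj X).trans (Category.id_comp (b.hom.app X)).symm))
    (fun f => Comonad.Coalgebra.Hom.ext
      ((Category.comp_id (F.map f)).trans (Category.id_comp (F.map f)).symm))

theorem isEquivalence_lift [∀ Y, IsIso ((b.comonadHom adj).app Y)]
    [(Comonad.comparison adj).IsEquivalence] : b.lift.IsEquivalence := by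
  have := isEquivalence_coalgebraFunctor (b.comonadHom adj)
  exact Functor.isEquivalence_of_iso (b.comparisonIso adj)

end Coaction

end Coaction

section Algebra

variable {A : Type u₁} [Category.{v₁} A] {E : Type u₂} [Category.{v₂} E]

theorem isIso_of_isColimit_cofork {X Y P X' Y' P' : E} {f g : X ⟶ Y} {π : Y ⟶ P}
    {f' g' : X' ⟶ Y'} {π' : Y' ⟶ P'} {w : f ≫ π = g ≫ π} {w' : f' ≫ π' = g' ≫ π'}
    (hπ : Limits.IsColimit (Limits.Cofork.ofπ π w))
    (hπ' : Limits.IsColimit (Limits.Cofork.ofπ π' w'))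
    (a : X ⟶ X') (b : Y ⟶ Y') (c : P ⟶ P') (ha : Epi a) (hb : IsIso b)
    (hf : f ≫ b = a ≫ f') (hg : g ≫ b = a ≫ g') (hc : π ≫ c = b ≫ π') : IsIso c := by
  have coforks : f' ≫ inv b ≫ π = g' ≫ inv b ≫ π := by
    rw [← cancel_epi a, ← reassoc_of% hf, ← reassoc_of% hg, IsIso.hom_inv_id_assoc, w]
  obtain ⟨ρ, hρ⟩ : {ρ : P' ⟶ P // π' ≫ ρ = inv b ≫ π} :=
    Limits.Cofork.IsColimit.desc' hπ' _ coforks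
  refine ⟨ρ, Limits.Cofork.IsColimit.hom_ext hπ ?_, Limits.Cofork.IsColimit.hom_ext hπ' ?_⟩
  · change π ≫ c ≫ ρ = π ≫ 𝟙 P
    rw [reassoc_of% hc, hρ, IsIso.hom_inv_id_assoc, Category.comp_id]
  · change π' ≫ ρ ≫ c = π' ≫ 𝟙 P'
    rw [reassoc_of% hρ, hc, IsIso.inv_hom_id_assoc, Category.comp_id]

theorem isIso_app_of_isIso_app_free {B : Monad A} {G H : A ⥤ E}
    (σ : B.forget ⋙ G ⟶ B.forget ⋙ H) (hσ : ∀ X, IsIso (σ.app (B.free.obj X))) (Y : B.Algebra) :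
    IsIso (σ.app Y) := by
  have := hσ (B.obj Y.A)
  have epi_free : Epi (σ.app (B.free.obj (B.obj Y.A))) := inferInstance
  exact isIso_of_isColimit_cofork ((Monad.beckSplitCoequalizer Y).map G).isCoequalizer
    ((Monad.beckSplitCoequalizer Y).map H).isCoequalizer
    (σ.app (B.free.obj (B.obj Y.A))) (σ.app (B.free.obj Y.A)) (σ.app Y)
    epi_free (hσ Y.A)
    (σ.naturality (Monad.FreeCoequalizer.topMap Y))
    (σ.naturality (Monad.FreeCoequalizer.bottomMap Y))
    (σ.naturality (Monad.FreeCoequalizer.π Y))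

end Algebra

section Fusion

variable {A : Type u₁} [Category.{v₁} A] [MonoidalCategory A]
  (B : Monad A) [B.toFunctor.OplaxMonoidal]

theorem isIso_freeCoaction_comp_mul (X : A) [IsIso (leftFusion B (𝟙_ A) X)] :
    IsIso (freeCoaction B (B.obj X) ≫ B.obj (𝟙_ A) ◁ B.μ.app X) := by
  have : freeCoaction B (B.obj X) ≫ B.obj (𝟙_ A) ◁ B.μ.app X =
      B.map (λ_ (B.obj X)).inv ≫ leftFusion B (𝟙_ A) X := Category.assoc _ _ _
  rw [this]
  infer_instance

variable [IsOpmonoidal B]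

/-- The coaction `B_2(𝟙, -)` of `C^θ` on the free algebra functor. -/
def freeCoalgebraCoaction : Coaction (liftComonad (fusionLaw B)) B.free where
  hom :=
    { app := fun X => ((comparisonK B).obj X).a
      naturality := fun _ _ f => ((comparisonK B).map f).h.symm }
  counit X := ((comparisonK B).obj X).counit
  coassoc X := ((comparisonK B).obj X).coassoc

theorem freeCoalgebraCoaction_lift : (freeCoalgebraCoaction B).lift = comparisonK B := rfl

/-- The comonad morphism `T ⟶ C^θ` corresponding to the coaction `B_2(𝟙, -)`. -/
def fusionComonadHom : freeComonad B ⟶ liftComonad (fusionLaw B) :=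
  (freeCoalgebraCoaction B).comonadHom B.adj

theorem fusionComonadHom_app_f (Y : B.Algebra) :
    ((fusionComonadHom B).app Y).f = freeCoaction B Y.A ≫ B.obj (𝟙_ A) ◁ Y.a := by
  change freeCoaction B Y.A ≫ B.obj (𝟙_ A) ◁ (B.adj.counit.app Y).f = _
  rw [adj_counit_app_f]

theorem isIso_fusionComonadHom_app (hB : ∀ X, IsIso (leftFusion B (𝟙_ A) X)) (Y : B.Algebra) :
    IsIso ((fusionComonadHom B).app Y) := by
  have free_iso (X : A) : IsIso ((fusionComonadHom B).app (B.free.obj X)).f := by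
    have := hB X
    rw [fusionComonadHom_app_f]
    exact isIso_freeCoaction_comp_mul B X
  have : IsIso ((fusionComonadHom B).app Y).f :=
    isIso_app_of_isIso_app_free (G := B.toFunctor) (H := (tensorComonad B).toFunctor)
      (Functor.whiskerRight (fusionComonadHom B).toNatTrans B.forget) free_iso Y
  exact Monad.algebra_iso_of_iso B _

theorem isEquivalence_comparisonK (hB : ∀ X, IsIso (leftFusion B (𝟙_ A) X))
    [(Comonad.comparison B.adj).IsEquivalence] : (comparisonK B).IsEquivalence := by
  have (Y : B.Algebra) : IsIso (((freeCoalgebraCoaction B).comonadHom B.adj).app Y) :=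
    isIso_fusionComonadHom_app B hB Y
  rw [← freeCoalgebraCoaction_lift]
  exact (freeCoalgebraCoaction B).isEquivalence_lift B.adj

end Fusion

end HopfMonads

theorem mainTheorem6_general {A : Type u₁} [Category.{v₁} A] [MonoidalCategory A]
    (B : Monad A) [B.toFunctor.OplaxMonoidal] [HopfMonads.IsOpmonoidal B]
    (hB : ∀ X, IsIso (HopfMonads.leftFusion B (𝟙_ A) X))
    (hF : (Comonad.comparison B.adj).IsEquivalence) :
    (HopfMonads.comparisonK B).IsEquivalence ∧
    ∀ (K' : (HopfMonads.liftComonad (HopfMonads.fusionLaw B)).Coalgebra ⥤ A)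
      (adj : K' ⊣ HopfMonads.comparisonK B)
      {Z : Type u₂} [Category.{v₂} Z] (N : B.Algebra ⥤ Z),
      Set.BijOn (HopfMonads.conjugateOpcoalgebra B N adj)
        {l | HopfMonads.IsLeftCoalgebra (HopfMonads.chi (HopfMonads.fusionLaw B)) N l}
        {γ | HopfMonads.IsOpcoalgebra
          (HopfMonads.conjugateComonad adj (HopfMonads.extensionComonad (HopfMonads.fusionLaw B)))
          (B.free ⋙ N) γ} := by
  have K_equivalence := HopfMonads.isEquivalence_comparisonK B hB
  exact ⟨K_equivalence, fun K' adj _ _ N =>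
    HopfMonads.bijOn_conjugateNabla_nabla (HopfMonads.fusionLaw B) N adj⟩

theorem mainTheorem6 {A : Type u₁} [Category.{v₁} A] [MonoidalCategory A]
    (B : Monad A) [B.toFunctor.OplaxMonoidal] [HopfMonads.IsOpmonoidal B]
    (hB : HopfMonads.IsPreHopf B)
    (hF : (Comonad.comparison B.adj).IsEquivalence) :
    (HopfMonads.comparisonK B).IsEquivalence ∧
    ∀ (K' : (HopfMonads.liftComonad (HopfMonads.fusionLaw B)).Coalgebra ⥤ A)
      (adj : K' ⊣ HopfMonads.comparisonK B)
      {Z : Type u₂} [Category.{v₂} Z] (N : B.Algebra ⥤ Z),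
      Set.BijOn (HopfMonads.conjugateOpcoalgebra B N adj)
        {l | HopfMonads.IsLeftCoalgebra (HopfMonads.chi (HopfMonads.fusionLaw B)) N l}
        {γ | HopfMonads.IsOpcoalgebra
          (HopfMonads.conjugateComonad adj (HopfMonads.extensionComonad (HopfMonads.fusionLaw B)))
          (B.free ⋙ N) γ} := by
  exact mainTheorem6_general B hB.left hF
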